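/- Let $K$ be a field, let $0<a<b<c$ be integers, and let $I=(u_1,u_2,u_3,u_4)\subset K[x,y]$ with $u_1=x^c$, $u_2=x^by^a$, $u_3=x^ay^b$, $u_4=y^c$. Let $F(I)=R(I)/\mathfrak m R(I)$ be the fiber cone of $I$, where $R(I)=\bigoplus_{k\ge 0}I^kt^k$ is the Rees ring and $\mathfrak m=(x,y)$, graded by the images $F(I)_k$ of $I^kt^k$, and let $\mathrm{Hilb}_{F(I)}(t)=\sum_{k\ge0}\dim_K F(I)_k\,t^k$. (a) If $2a\ge c$, then (i) $F(I)\cong K[z_1,z_2,z_3,z_4]/(z_2z_3,\,z_2^2,\,z_3^2)$; (ii) $\mathrm{Hilb}_{F(I)}(t)=(1+2t)/(1-t)^2$; (iii) $F(I)$ is Cohen–Macaulay. (b) If $c>r(b-a)+a$, where $r=\lceil b/(b-a)\rceil$, then (i) $F(I)\cong K[z_1,z_2,z_3,z_4]/(z_1z_3^{r-1},\,z_2^{r-1}z_4,\,z_1z_4)$; (ii) $\mathrm{Hilb}_{F(I)}(t)=\bigl(1+2\sum_{i=1}^{r-1}t^i\bigr)/(1-t)^2$; (iii) $F(I)$ is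 Cohen–Macaulay. In both cases the isomorphism in (i) is an isomorphism of $K$-algebras that sends the class of $z_i$ to the class of $u_it$ in $F(I)_1$, for $i=1,\dots,4$. -/

import Mathlib

open MvPolynomial

noncomputable section

universe u v

/-! ### The fiber cone of an ideal of a polynomial ring -/

/-- The fiber cone `F(I) = R(I) / 𝔪 R(I)` of an ideal `I` of `K[x_i : i ∈ σ]`, where
`R(I) = ⨁ₖ Iᵏ tᵏ` is the Rees ring and `𝔪` is the ideal generated by the variables. -/
abbrev FiberCone {K : Type u} [Field K] {σ : Type v} (I : Ideal (MvPolynomial σ K)) :=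
  reesAlgebra I ⧸
    (Ideal.span (Set.range (X : σ → MvPolynomial σ K))).map
      (algebraMap (MvPolynomial σ K) (reesAlgebra I))

namespace FiberCone

variable {K : Type u} [Field K] {σ : Type v}

/-- The `K`-linear map `Iᵏ → F(I)` that sends `f` to the residue class of `f tᵏ`. -/
def classOf (I : Ideal (MvPolynomial σ K)) (k : ℕ) :
    (I ^ k).restrictScalars K →ₗ[K] FiberCone I where
  toFun f := Ideal.Quotient.mk _
    (⟨Polynomial.monomial k f.1, reesAlgebra.monomial_mem.mpr f.2⟩ : reesAlgebra I)
  map_add' f g := by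
    rw [← map_add]
    congr 1
    ext1
    simp
  map_smul' r f := by
    rw [RingHom.id_apply, ← Ideal.Quotient.mkₐ_eq_mk K, ← map_smul]
    congr 1
    ext1
    exact (Polynomial.smul_monomial r k f.1).symm

/-- The graded component `F(I)ₖ`: the residue classes of the elements of `Iᵏ tᵏ`. -/
def component (I : Ideal (MvPolynomial σ K)) (k : ℕ) : Submodule K (FiberCone I) :=
  LinearMap.range (classOf I k)

/-- The Hilbert series `∑ₖ (dim_K F(I)ₖ) tᵏ`. -/
def hilbertSeries (I : Ideal (MvPolynomial σ K)) : PowerSeries ℚ :=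
  PowerSeries.mk fun k => (Module.finrank K (component I k) : ℚ)

end FiberCone

/-! ### Cohen–Macaulay rings -/

/-- The depth of a local ring: the supremum of the lengths of the regular sequences
contained in its maximal ideal. -/
def localDepth (R : Type u) [CommRing R] [IsLocalRing R] : ℕ∞ :=
  ⨆ (rs : List R) (_ : RingTheory.Sequence.IsRegular R rs)
    (_ : ∀ x ∈ rs, x ∈ IsLocalRing.maximalIdeal R), (rs.length : ℕ∞)

/-- A Noetherian ring is Cohen–Macaulay if depth and Krull dimension agree for its
localization at every maximal ideal. -/
structure IsCohenMacaulayRing (R : Type u) [CommRing R] : Prop where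
  isNoetherianRing : IsNoetherianRing R
  depth_eq_dim : ∀ (n : Ideal R) [n.IsMaximal],
    (localDepth (Localization.AtPrime n) : WithBot ℕ∞) =
      ringKrullDim (Localization.AtPrime n)

/-! ### The four-generated symmetric ideal -/

/-- The monomials `x^c, x^b y^a, x^a y^b, y^c` of `K[x, y]` (`x = X 0`, `y = X 1`). -/
def symmGen (K : Type u) [Field K] (a b c : ℕ) : Fin 4 → MvPolynomial (Fin 2) K :=
  ![X 0 ^ c, X 0 ^ b * X 1 ^ a, X 0 ^ a * X 1 ^ b, X 1 ^ c]

/-- The ideal `(x^c, x^b y^a, x^a y^b, y^c)` of `K[x, y]`. -/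
def symmIdeal (K : Type u) [Field K] (a b c : ℕ) : Ideal (MvPolynomial (Fin 2) K) :=
  Ideal.span (Set.range (symmGen K a b c))

theorem symmGen_mem (K : Type u) [Field K] (a b c : ℕ) (i : Fin 4) :
    symmGen K a b c i ∈ (symmIdeal K a b c ^ 1).restrictScalars K := by
  rw [pow_one]
  exact Ideal.subset_span ⟨i, rfl⟩

/-- The residue class in `F(I)₁` of the `i`-th monomial generator of `I`. -/
def symmClass (K : Type u) [Field K] (a b c : ℕ) (i : Fin 4) : FiberCone (symmIdeal K a b c) :=
  FiberCone.classOf (symmIdeal K a b c) 1 ⟨symmGen K a b c i, symmGen_mem K a b c i⟩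

/-- The ideal `(z₂z₃, z₂², z₃²)` of `K[z₁, z₂, z₃, z₄]`, with `zᵢ` written `X (i - 1)`. -/
def relIdealA (K : Type u) [Field K] : Ideal (MvPolynomial (Fin 4) K) :=
  Ideal.span {X 1 * X 2, X 1 ^ 2, X 2 ^ 2}

/-- The ideal `(z₁z₃^(r-1), z₂^(r-1)z₄, z₁z₄)` of `K[z₁, z₂, z₃, z₄]`,
with `zᵢ` written `X (i - 1)`; used for `r ≥ 2` only. -/
def relIdealB (K : Type u) [Field K] (r : ℕ) : Ideal (MvPolynomial (Fin 4) K) :=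
  Ideal.span {X 0 * X 2 ^ (r - 1), X 1 ^ (r - 1) * X 3, X 0 * X 3}

end

/-! Everything reduces to comparing products of generators. A monomial `z^α` maps to the class of
`u^α t^|α|`. It dies in the fiber cone when some `u^β` with `|β| = |α|` strictly divides `u^α`,
because the quotient lies in `𝔪`. Conversely, if `α` is rigid, the coefficient of `u^α t^|α|` is a
functional on the Rees ring that vanishes on `𝔪 R(I)` and reads off the coefficient of `z^α`. So if
every generator of a monomial ideal `J` is killed by strict divisibility and every monomial outside
`J` is rigid, then `J` is the full kernel, and the standard monomials form a basis and give the
Hilbert series (`ker_toFiberCone_eq_span_monomial`, `finrank_component_eq_card`).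

In case (a), `u₁u₄` strictly divides `u₂u₃`, `u₂²`, `u₃²`. In case (b), `u₂u₃` strictly divides
`u₁u₄`, while `u₂^r` and `u₃^r` strictly divide `u₁u₃^(r-1)` and `u₂^(r-1)u₄`; the ceiling makes `r`
the least exponent for which this works. Rigidity of the remaining monomials follows from comparing
total degrees, then the degrees in `x` and `y`.

For Cohen–Macaulayness, the quotient is shown to be finite and free over a polynomial ring
`K[s][t]`, with `s = z₁`, `t = z₄` in (a) and `s = z₁ + z₃`, `t = z₂ + z₄` in (b)
(`free_finite_of_two_branches`, `isCohenMacaulayRing_of_free`). -/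

/-! ### Finite free algebras over `K[s][t]` are Cohen–Macaulay. -/

section CohenMacaulay

-- `C p` is prime, and it cannot divide `q.map C`, whose leading coefficient is `1`. Hence `q.map C`
-- is a nonzerodivisor modulo `C p`.
open Polynomial in
theorem isWeaklyRegular_C_map_C {K : Type u} [Field K] {p q : K[X]} (hp : Irreducible p)
    (hq : q.Monic) :
    RingTheory.Sequence.IsWeaklyRegular K[X][X] [Polynomial.C p, q.map Polynomial.C] := by
  have hpr : Prime (Polynomial.C p : K[X][X]) := Polynomial.prime_C_iff.mpr hp.prime
  rw [RingTheory.Sequence.isWeaklyRegular_cons_iff, RingTheory.Sequence.isWeaklyRegular_singleton_iff]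
  refine ⟨IsSMulRegular.of_right_eq_zero_of_smul fun f hf => ?_, ?_⟩
  · simpa [hpr.ne_zero] using hf
  · refine IsSMulRegular.of_right_eq_zero_of_smul fun f => ?_
    obtain ⟨f, rfl⟩ := Submodule.Quotient.mk_surjective _ f
    rw [← Submodule.Quotient.mk_smul, Submodule.Quotient.mk_eq_zero,
      Submodule.Quotient.mk_eq_zero]
    intro h
    rw [Submodule.mem_smul_pointwise_iff_exists] at h ⊢
    obtain ⟨g, -, hg⟩ := h
    have hd : Polynomial.C p ∣ q.map Polynomial.C * f := ⟨g, by simpa using hg.symm⟩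
    rcases hpr.dvd_or_dvd hd with h | ⟨t, ht⟩
    · exfalso
      have := (Polynomial.C_dvd_iff_dvd_coeff _ _).mp h (q.natDegree)
      rw [Polynomial.coeff_map, hq.coeff_natDegree, map_one] at this
      exact hp.not_isUnit (isUnit_of_dvd_one this)
    · exact ⟨t, trivial, by simp [ht]⟩

theorem ringKrullDim_le_of_isIntegral (A : Type u) (B : Type v) [CommRing A] [CommRing B]
    [Algebra A B] [Algebra.IsIntegral A B] : ringKrullDim B ≤ ringKrullDim A :=
  Order.krullDim_le_of_strictMono (PrimeSpectrum.comap (algebraMap A B)) fun _ _ h =>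
    Ideal.IsIntegral.comap_lt_comap h

theorem localDepth_le_ringKrullDim (R : Type u) [CommRing R] [IsLocalRing R] [IsNoetherianRing R] :
    (localDepth R : WithBot ℕ∞) ≤ ringKrullDim R := by
  obtain ⟨d, hd⟩ : ∃ d : ℕ∞, ringKrullDim R = d :=
    ⟨_, (WithBot.coe_unbot _ ringKrullDim_ne_bot).symm⟩
  rw [hd, WithBot.coe_le_coe]
  refine iSup_le fun rs => iSup_le fun hrs => iSup_le fun _ => ?_
  have h := ringKrullDim_add_length_eq_ringKrullDim_of_isRegular rs hrs
  rw [← WithBot.coe_le_coe, ← hd, ← h]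
  have : Nontrivial (R ⧸ Ideal.ofList rs) := by
    refine Ideal.Quotient.nontrivial_iff.mpr fun h => hrs.2 ?_
    simp [h]
  have := ringKrullDim_nonneg_of_nontrivial (R := R ⧸ Ideal.ofList rs)
  calc ((rs.length : ℕ∞) : WithBot ℕ∞) = 0 + (rs.length : WithBot ℕ∞) := by simp
    _ ≤ _ := by gcongr

-- A maximal ideal of `B` contracts to a maximal ideal `m` whose residue field is finite over `K`.
-- The minimal polynomials of the residues of the two variables lie in `m` and form a regular
-- sequence, which stays regular in `B` by flatness and after localizing. So the depth is at least
-- 2, while integrality bounds the dimension by 2.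
open Polynomial in
theorem isCohenMacaulayRing_of_free {K : Type u} [Field K] (B : Type v) [CommRing B]
    [Algebra K[X][X] B] [Module.Free K[X][X] B] [Module.Finite K[X][X] B] :
    IsCohenMacaulayRing B := by
  have hnoeth : IsNoetherianRing B := IsNoetherianRing.of_finite K[X][X] B
  refine ⟨hnoeth, fun n hn => le_antisymm (localDepth_le_ringKrullDim _) ?_⟩
  have hm : (n.comap (algebraMap K[X][X] B)).IsMaximal := Ideal.isMaximal_comap_of_isIntegral_of_isMaximal n
  set m := n.comap (algebraMap K[X][X] B) with hmdef
  let : Field (K[X][X] ⧸ m) := Ideal.Quotient.field m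
  have hfin : Module.Finite K (K[X][X] ⧸ m) := finite_of_finite_type_of_isJacobsonRing K _
  have hint : Algebra.IsIntegral K (K[X][X] ⧸ m) := Algebra.IsIntegral.of_finite K _
  let s : K[X][X] ⧸ m := Ideal.Quotient.mk m (Polynomial.C Polynomial.X)
  let t : K[X][X] ⧸ m := Ideal.Quotient.mk m Polynomial.X
  have hs : Polynomial.C (minpoly K s) ∈ m := by
    rw [← Ideal.Quotient.eq_zero_iff_mem]
    have h := minpoly.aeval K s
    have e : ((Ideal.Quotient.mkₐ K m).comp ((Polynomial.CAlgHom : K[X] →ₐ[K[X]] K[X][X]).restrictScalars K)) = Polynomial.aeval s := by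
      ext; simp [s]
    rw [← e] at h
    exact h
  have ht : (minpoly K t).map Polynomial.C ∈ m := by
    rw [← Ideal.Quotient.eq_zero_iff_mem]
    have h := minpoly.aeval K t
    have e : ((Ideal.Quotient.mkₐ K m).comp (Polynomial.mapAlgHom (Algebra.ofId K K[X]))) = Polynomial.aeval t := by
      ext; simp [t]
    rw [← e] at h
    exact h
  have hreg := (isWeaklyRegular_C_map_C (minpoly.irreducible (hint.isIntegral s))
    (minpoly.monic (hint.isIntegral t))).of_flat (S := B)
  have hreg' := hreg.isRegular_of_isLocalization_of_mem (Localization.AtPrime n) n (by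
    intro x hx
    simp only [List.map_cons, List.map_nil, List.mem_cons, List.not_mem_nil, or_false] at hx
    rcases hx with rfl | rfl
    exacts [hs, ht])
  have hdepth : (2 : ℕ∞) ≤ localDepth (Localization.AtPrime n) := by
    refine le_trans ?_ (le_iSup_of_le _ (le_iSup_of_le hreg' (le_iSup_of_le ?_ le_rfl)))
    · simp
    · intro x hx
      simp only [List.map_cons, List.map_nil, List.mem_cons, List.not_mem_nil, or_false] at hx
      rcases hx with rfl | rfl
      · exact (IsLocalization.AtPrime.to_map_mem_maximal_iff _ n _).mpr hs
      · exact (IsLocalization.AtPrime.to_map_mem_maximal_iff _ n _).mpr ht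
  have hdim : ringKrullDim (Localization.AtPrime n) ≤ 2 := by
    rw [IsLocalization.AtPrime.ringKrullDim_eq_height n]
    refine Ideal.height_le_ringKrullDim_of_isPrime.trans
      ((ringKrullDim_le_of_isIntegral K[X][X] B).trans ?_)
    rw [Polynomial.ringKrullDim_of_isNoetherianRing, Polynomial.ringKrullDim_of_isNoetherianRing,
      ringKrullDim_eq_zero_of_field]
    norm_num
  exact hdim.trans (WithBot.coe_le_coe.mpr hdepth)

end CohenMacaulay

/-! ### Freeness of an algebra glued from two branches. -/

section TwoBranches

open scoped Polynomial

/-- The relation `huv` is `(u - α)(v - β) = 0` expanded. It rewrites `u * v ^ (s + 1)` through `u *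
v ^ s` and powers of `v`, so mixed products reduce by induction on `s`. -/
theorem mul_mem_span_pow_union {A : Type u} {B : Type v} [CommRing A] [CommRing B] [Algebra A B]
    {α β : A} {n : ℕ} {u v : B}
    (hu : u ^ (n + 1) = α • u ^ n) (huv : u * v = α • v + β • u - algebraMap A B (α * β)) {x : B}
    (hx : x ∈ Submodule.span A ((u ^ ·) '' Set.Iic n ∪ (v ^ ·) '' Set.Iic n)) :
    u * x ∈ Submodule.span A ((u ^ ·) '' Set.Iic n ∪ (v ^ ·) '' Set.Iic n) := by
  set N := Submodule.span A ((u ^ ·) '' Set.Iic n ∪ (v ^ ·) '' Set.Iic n) with hN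
  have hun : ∀ s ≤ n, u ^ s ∈ N := fun s hs => Submodule.subset_span (Or.inl ⟨s, hs, rfl⟩)
  have hvn : ∀ s ≤ n, v ^ s ∈ N := fun s hs => Submodule.subset_span (Or.inr ⟨s, hs, rfl⟩)
  have h1 : ∀ s ≤ n, u * u ^ s ∈ N := by
    intro s hs
    rw [← pow_succ']
    rcases hs.lt_or_eq with h | rfl
    · exact hun _ h
    · rw [hu]
      exact N.smul_mem _ (hun _ le_rfl)
  have h2 : ∀ s ≤ n, u * v ^ s ∈ N := by
    intro s
    induction s with
    | zero => intro h; simpa using h1 0 h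
    | succ s ih =>
      intro h
      have e : u * v ^ (s + 1) = α • v ^ (s + 1) + β • (u * v ^ s) - (α * β) • v ^ s := by
        rw [pow_succ', ← mul_assoc, huv, Algebra.smul_def, Algebra.smul_def, Algebra.smul_def,
          Algebra.smul_def, Algebra.smul_def]
        ring
      rw [e]
      exact N.sub_mem (N.add_mem (N.smul_mem _ (hvn _ h)) (N.smul_mem _ (ih (by omega))))
        (N.smul_mem _ (hvn _ (by omega)))
  induction hx using Submodule.span_induction with
  | mem x hx =>
    rcases hx with ⟨s, hs, rfl⟩ | ⟨s, hs, rfl⟩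
    exacts [h1 s hs, h2 s hs]
  | zero => simp
  | add x y _ _ hx hy => rw [mul_add]; exact N.add_mem hx hy
  | smul a x _ hx => rw [mul_smul_comm]; exact N.smul_mem _ hx

theorem span_pow_union_eq_top {A : Type u} {B : Type v} [CommRing A] [CommRing B] [Algebra A B]
    {α β : A} {n : ℕ} {u v : B} (hgen : Algebra.adjoin A {u, v} = ⊤)
    (hu : u ^ (n + 1) = α • u ^ n) (hv : v ^ (n + 1) = β • v ^ n)
    (huv : u * v = α • v + β • u - algebraMap A B (α * β)) :
    Submodule.span A ((u ^ ·) '' Set.Iic n ∪ (v ^ ·) '' Set.Iic n) = ⊤ := by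
  set N := Submodule.span A ((u ^ ·) '' Set.Iic n ∪ (v ^ ·) '' Set.Iic n) with hN
  have hmul : ∀ x ∈ Algebra.adjoin A {u, v}, ∀ y ∈ N, x * y ∈ N := by
    intro x hx
    induction hx using Algebra.adjoin_induction with
    | mem x hx =>
      rcases hx with rfl | rfl
      · exact fun y hy => mul_mem_span_pow_union hu huv hy
      · intro y hy
        -- The relations are symmetric under exchanging `(u, α)` with `(v, β)`.
        rw [hN, Set.union_comm] at hy ⊢
        refine mul_mem_span_pow_union hv (β := α) ?_ hy
        rw [mul_comm, huv, add_comm, mul_comm α]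
    | algebraMap r => intro y hy; rw [← Algebra.smul_def]; exact N.smul_mem _ hy
    | add x x' _ _ h h' => intro y hy; rw [add_mul]; exact N.add_mem (h y hy) (h' y hy)
    | mul x x' _ _ h h' => intro y hy; rw [mul_assoc]; exact h _ (h' y hy)
  refine eq_top_iff.mpr fun x _ => ?_
  simpa using hmul x (hgen ▸ Algebra.mem_top) 1
    (Submodule.subset_span (Or.inl ⟨0, Nat.zero_le _, pow_zero u⟩))

theorem AdjoinRoot.eq_zero_of_aeval_root {A : Type u} [CommRing A] {f P : A[X]}
    (hf : f.Monic) (hd : P.degree < f.degree) (h : Polynomial.aeval (AdjoinRoot.root f) P = 0) :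
    P = 0 := by
  rw [AdjoinRoot.aeval_eq] at h
  by_contra h0
  exact AdjoinRoot.mk_ne_zero_of_degree_lt hf h0 hd h

theorem monic_X_sub_C_mul_X_pow {A : Type u} [CommRing A] (α : A) (n : ℕ) :
    ((Polynomial.X - Polynomial.C α) * Polynomial.X ^ n : A[X]).Monic :=
  (Polynomial.monic_X_sub_C α).mul (Polynomial.monic_X_pow n)

theorem degree_X_sub_C_mul_X_pow {A : Type u} [CommRing A] [Nontrivial A] (α : A) (n : ℕ) :
    ((Polynomial.X - Polynomial.C α) * Polynomial.X ^ n : A[X]).degree = (n + 1 : ℕ) := by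
  rw [Polynomial.Monic.degree_mul (Polynomial.monic_X_pow n), Polynomial.degree_X_sub_C,
    Polynomial.degree_X_pow, add_comm]
  rfl

/-- Since `(u - α)(v - β) = 0`, there are two branches, `v = β` and `u = α`. The maps `p` and `q`
project to them, and on each the surviving generator satisfies a monic equation of degree `n + 1`. A
linear relation among the spanning powers becomes on each branch a polynomial of degree at most `n`
vanishing at the root, hence zero. -/
theorem free_finite_of_two_branches {A : Type u} {B : Type v} [CommRing A] [Nontrivial A]
    [CommRing B] [Algebra A B]
    {α β : A} {n : ℕ} {u v : B} (hgen : Algebra.adjoin A {u, v} = ⊤)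
    (hu : u ^ (n + 1) = α • u ^ n) (hv : v ^ (n + 1) = β • v ^ n)
    (huv : u * v = α • v + β • u - algebraMap A B (α * β))
    (p : B →ₐ[A] AdjoinRoot ((Polynomial.X - Polynomial.C α) * Polynomial.X ^ n))
    (hpu : p u = AdjoinRoot.root _) (hpv : p v = algebraMap _ _ β)
    (q : B →ₐ[A] AdjoinRoot ((Polynomial.X - Polynomial.C β) * Polynomial.X ^ n))
    (hqv : q v = AdjoinRoot.root _) (hqu : q u = algebraMap _ _ α) :
    Module.Free A B ∧ Module.Finite A B := by
  -- The powers of `v` start at exponent 1, since `v ^ 0 = u ^ 0`.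
  let w : Fin (n + 1) ⊕ Fin n → B := Sum.elim (fun s => u ^ (s : ℕ)) (fun s => v ^ (s + 1 : ℕ))
  have hspan : ⊤ ≤ Submodule.span A (Set.range w) := by
    rw [← span_pow_union_eq_top hgen hu hv huv]
    refine Submodule.span_mono ?_
    rintro _ (⟨s, hs, rfl⟩ | ⟨s, hs, rfl⟩)
    · exact ⟨Sum.inl ⟨s, Nat.lt_succ_of_le hs⟩, rfl⟩
    · rcases s with _ | s
      · exact ⟨Sum.inl 0, by simp [w]⟩
      · exact ⟨Sum.inr ⟨s, hs⟩, rfl⟩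
  have hli : LinearIndependent A w := by
    rw [Fintype.linearIndependent_iff]
    intro g hg
    simp only [Fintype.sum_sum_type, w, Sum.elim_inl, Sum.elim_inr] at hg
    let P : A[X] := ∑ s : Fin (n + 1), Polynomial.C (g (Sum.inl s)) * Polynomial.X ^ (s : ℕ) +
      Polynomial.C (∑ s : Fin n, g (Sum.inr s) * β ^ (s + 1 : ℕ))
    let Q : A[X] := ∑ s : Fin n, Polynomial.C (g (Sum.inr s)) * Polynomial.X ^ (s + 1 : ℕ) +
      Polynomial.C (∑ s : Fin (n + 1), g (Sum.inl s) * α ^ (s : ℕ))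
    have hP : P = 0 := by
      refine AdjoinRoot.eq_zero_of_aeval_root (monic_X_sub_C_mul_X_pow α n) ?_ ?_
      · rw [degree_X_sub_C_mul_X_pow]
        refine (Polynomial.degree_add_le _ _).trans_lt (max_lt ?_ ?_)
        · refine Polynomial.degree_sum_fin_lt _
        · exact Polynomial.degree_C_le.trans_lt (by exact_mod_cast Nat.succ_pos n)
      · have := congrArg p hg
        simpa [P, hpu, hpv, Algebra.smul_def] using this
    have hQ : Q = 0 := by
      refine AdjoinRoot.eq_zero_of_aeval_root (monic_X_sub_C_mul_X_pow β n) ?_ ?_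
      · rw [degree_X_sub_C_mul_X_pow]
        refine (Polynomial.degree_add_le _ _).trans_lt (max_lt ?_ ?_)
        · refine (Polynomial.degree_sum_le _ _).trans_lt ?_
          rw [Finset.sup_lt_iff (by exact WithBot.bot_lt_coe _)]
          intro s _
          refine (Polynomial.degree_C_mul_X_pow_le _ _).trans_lt ?_
          have := s.2
          exact_mod_cast (by omega : (s : ℕ) + 1 < n + 1)
        · exact Polynomial.degree_C_le.trans_lt (by exact_mod_cast Nat.succ_pos n)
      · have := congrArg q hg
        rw [add_comm] at this
        simpa [Q, hqu, hqv, Algebra.smul_def] using this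
    -- All `u`-terms collapse into the constant term of `Q`, so its coefficients in positive degree
    -- are exactly those of the powers of `v`. Once they vanish, `P` retains only the coefficients
    -- of the powers of `u`.
    have hr : ∀ s : Fin n, g (Sum.inr s) = 0 := by
      intro s
      have := congrArg (fun R => Polynomial.coeff R (s + 1 : ℕ)) hQ
      simpa [-map_sum, Q, Polynomial.finsetSum_coeff, Polynomial.coeff_C, Polynomial.coeff_X_pow,
        Fin.val_inj, eq_comm] using this
    have hl : ∀ s : Fin (n + 1), g (Sum.inl s) = 0 := by
      intro s
      have := congrArg (fun R => Polynomial.coeff R (s : ℕ)) hP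
      simpa [P, hr, Polynomial.finsetSum_coeff, Polynomial.coeff_X_pow,
        Fin.val_inj, eq_comm] using this
    rintro (s | s)
    exacts [hl s, hr s]
  let b := Module.Basis.mk hli hspan
  exact ⟨Module.Free.of_basis b, Module.Finite.of_basis b⟩

end TwoBranches

/-! ### Fiber cones of monomial ideals. -/

noncomputable section MonomialFiberCone

variable {K : Type u} [Field K] {σ : Type v} {τ : Type*} {I : Ideal (MvPolynomial σ K)}
  {e : τ → σ →₀ ℕ}

theorem exists_linearCombination_le_of_mem_pow
    (hI : I = Ideal.span (Set.range fun i => monomial (e i) (1 : K))) (k : ℕ)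
    {f : MvPolynomial σ K} (hf : f ∈ I ^ k) {d : σ →₀ ℕ} (hd : coeff d f ≠ 0) :
    ∃ β : τ →₀ ℕ, β.degree = k ∧ Finsupp.linearCombination ℕ e β ≤ d := by
  classical
  induction k generalizing f d with
  | zero => exact ⟨0, by simp, by simp⟩
  | succ k ih =>
    rw [pow_succ] at hf
    induction hf using Submodule.mul_induction_on' generalizing d with
    | mem_mul_mem f hf g hg =>
      have hd' : d ∈ (f * g).support := mem_support_iff.mpr hd
      obtain ⟨d₁, h₁, d₂, h₂, rfl⟩ := Finset.mem_add.mp (support_mul f g hd')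
      obtain ⟨β, rfl, hβ⟩ := ih hf (mem_support_iff.mp h₁)
      rw [hI, Set.range_comp' (fun d => monomial d (1 : K)) e,
        mem_ideal_span_monomial_image] at hg
      obtain ⟨_, ⟨i, rfl⟩, hi⟩ := hg d₂ h₂
      exact ⟨β + Finsupp.single i 1, by simp, by simpa using add_le_add hβ hi⟩
    | add f _ g _ hf hg =>
      rw [coeff_add] at hd
      by_cases h : coeff d f = 0
      · exact hg (by simpa [h] using hd)
      · exact hf h

theorem monomial_linearCombination_mem_pow
    (hI : I = Ideal.span (Set.range fun i => monomial (e i) (1 : K))) (β : τ →₀ ℕ) :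
    monomial (Finsupp.linearCombination ℕ e β) (1 : K) ∈ I ^ β.degree := by
  induction β using Finsupp.induction_linear with
  | zero => simp
  | add f g hf hg =>
    have := Ideal.mul_mem_mul hf hg
    rwa [monomial_mul, one_mul, ← map_add, ← pow_add, ← map_add] at this
  | single i k =>
    have : monomial (e i) (1 : K) ∈ I := hI ▸ Ideal.subset_span ⟨i, rfl⟩
    simpa [monomial_pow] using Ideal.pow_mem_pow this k

theorem pow_eq_span_monomial_linearCombination
    (hI : I = Ideal.span (Set.range fun i => monomial (e i) (1 : K))) (k : ℕ) :
    I ^ k = Ideal.span ((fun d => monomial d (1 : K)) ''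
      (Finsupp.linearCombination ℕ e '' {β | β.degree = k})) := by
  refine le_antisymm (fun f hf => ?_) (Ideal.span_le.mpr ?_)
  · rw [mem_ideal_span_monomial_image]
    intro d hd
    obtain ⟨β, hβ, hle⟩ := exists_linearCombination_le_of_mem_pow hI k hf (mem_support_iff.mp hd)
    exact ⟨_, ⟨β, hβ, rfl⟩, hle⟩
  · rintro _ ⟨_, ⟨β, rfl, rfl⟩, rfl⟩
    exact monomial_linearCombination_mem_pow hI β

/-- An exponent vector is rigid if the corresponding product of generators is divisible by
no other product of the same number of generators. -/
def IsRigidExponent (e : τ → σ →₀ ℕ) (α : τ →₀ ℕ) : Prop :=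
  ∀ β : τ →₀ ℕ, β.degree = α.degree →
    Finsupp.linearCombination ℕ e β ≤ Finsupp.linearCombination ℕ e α → β = α

/-- If the coefficient were nonzero for a multiple of `X i`, then `u^α / x_i` would be divisible by
a product `u^β` of equally many generators. Rigidity forces `β = α`, which is absurd. -/
theorem coeff_coeff_eq_zero_of_mem_map_span_X
    (hI : I = Ideal.span (Set.range fun i => monomial (e i) (1 : K))) {α : τ →₀ ℕ}
    (hα : IsRigidExponent e α) {f : reesAlgebra I}
    (hf : f ∈ (Ideal.span (Set.range (X : σ → MvPolynomial σ K))).map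
      (algebraMap (MvPolynomial σ K) (reesAlgebra I))) :
    coeff (Finsupp.linearCombination ℕ e α) ((f : Polynomial (MvPolynomial σ K)).coeff α.degree)
      = 0 := by
  classical
  -- The claim is strengthened to all multiples of `f` so that span induction passes through scalar
  -- multiplication.
  suffices h : ∀ g : reesAlgebra I, coeff (Finsupp.linearCombination ℕ e α)
      (((g * f : reesAlgebra I) : Polynomial (MvPolynomial σ K)).coeff α.degree) = 0 by
    simpa using h 1
  rw [Ideal.map_span] at hf
  induction hf using Submodule.span_induction with
  | mem f hf =>
    obtain ⟨_, ⟨i, rfl⟩, rfl⟩ := hf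
    intro g
    have hg : ((g * algebraMap (MvPolynomial σ K) (reesAlgebra I) (X i) : reesAlgebra I) :
        Polynomial (MvPolynomial σ K)).coeff α.degree
        = (g : Polynomial (MvPolynomial σ K)).coeff α.degree * X i := by
      rw [← Polynomial.coeff_mul_C]; rfl
    rw [hg, coeff_mul_X']
    split_ifs with hi
    · by_contra h
      obtain ⟨β, hβ, hle⟩ := exists_linearCombination_le_of_mem_pow hI _ (g.2 α.degree) h
      obtain rfl := hα β hβ (hle.trans tsub_le_self)
      have := hle i
      simp only [Finsupp.coe_tsub, Pi.sub_apply, Finsupp.single_eq_same] at this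
      have := Finsupp.mem_support_iff.mp hi
      omega
    · rfl
  | zero => simp
  | add f g _ _ hf hg => 
    intro h
    rw [mul_add, Subalgebra.coe_add, Polynomial.coeff_add, coeff_add, hf, hg, add_zero]
  | smul r f _ hf => intro g; rw [smul_eq_mul, ← mul_assoc]; exact hf _

namespace FiberCone

/-- A polynomial differs from its constant term by an element of `𝔪`, so it acts on the fiber cone
through that constant. -/
theorem mk_algebraMap_eq (I : Ideal (MvPolynomial σ K)) (r : MvPolynomial σ K) :
    (Ideal.Quotient.mk _ (algebraMap (MvPolynomial σ K) (reesAlgebra I) r) : FiberCone I) =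
      algebraMap K (FiberCone I) (constantCoeff r) := by
  have h : (algebraMap K (FiberCone I) (constantCoeff r)) =
      Ideal.Quotient.mk _ (algebraMap (MvPolynomial σ K) (reesAlgebra I) (C (constantCoeff r))) :=
    rfl
  rw [h, Ideal.Quotient.mk_eq_mk_iff_sub_mem, ← map_sub]
  refine Ideal.mem_map_of_mem _ ?_
  rw [← Set.image_univ, mem_ideal_span_X_image]
  intro m hm
  by_contra! h0
  obtain rfl : m = 0 := Finsupp.ext fun i => h0 i trivial
  simp [← constantCoeff_eq] at hm

/-- The `K`-algebra map from a polynomial ring to the Rees algebra that sends the variables to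
the degree-one elements given by a family of elements of the ideal. -/
def ofGenerators (I : Ideal (MvPolynomial σ K)) (g : τ → MvPolynomial σ K)
    (hg : ∀ i, g i ∈ I ^ 1) : MvPolynomial τ K →ₐ[K] reesAlgebra I :=
  aeval fun i => ⟨Polynomial.monomial 1 (g i), reesAlgebra.monomial_mem.mpr (hg i)⟩

variable (hg : ∀ i, monomial (e i) (1 : K) ∈ I ^ 1)

theorem ofGenerators_monomial (α : τ →₀ ℕ) (c : K) :
    (ofGenerators I (fun i => monomial (e i) (1 : K)) hg (monomial α c) :
      Polynomial (MvPolynomial σ K)) =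
      Polynomial.monomial α.degree (monomial (Finsupp.linearCombination ℕ e α) c) := by
  have h1 : (ofGenerators I (fun i => monomial (e i) (1 : K)) hg (monomial α 1) :
      Polynomial (MvPolynomial σ K)) =
      Polynomial.monomial α.degree (monomial (Finsupp.linearCombination ℕ e α) 1) := by
    induction α using Finsupp.induction_linear with
    | zero => simp
    | add f g hf hg =>
      have : monomial (f + g) (1 : K) = monomial f 1 * monomial g 1 := by simp
      rw [this, map_mul, MulMemClass.coe_mul, hf, hg,
        Polynomial.monomial_mul_monomial, monomial_mul, map_add, map_add, one_mul]
    | single i k =>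
      have : monomial (Finsupp.single i k) (1 : K) = X i ^ k := by
        rw [X_pow_eq_monomial]
      rw [this, map_pow, ofGenerators, aeval_X]
      simp [Polynomial.monomial_pow, monomial_pow]
  have h2 : monomial α c = c • monomial α (1 : K) := by simp [smul_monomial]
  rw [h2, map_smul]
  change c • (ofGenerators I (fun i => monomial (e i) (1 : K)) hg (monomial α 1) :
      Polynomial (MvPolynomial σ K)) = _
  rw [h1, Polynomial.smul_monomial, smul_monomial, smul_eq_mul, mul_one]

/-- By rigidity no other product of equally many generators equals `u^α`, so nothing else
contributes to this coefficient. -/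
theorem coeff_coeff_ofGenerators {α : τ →₀ ℕ} (hα : IsRigidExponent e α) (f : MvPolynomial τ K) :
    coeff (Finsupp.linearCombination ℕ e α)
      ((ofGenerators I (fun i => monomial (e i) (1 : K)) hg f :
        Polynomial (MvPolynomial σ K)).coeff α.degree) = coeff α f := by
  classical
  induction f using MvPolynomial.induction_on' with
  | monomial β c =>
    rw [ofGenerators_monomial, Polynomial.coeff_monomial, coeff_monomial]
    by_cases h : β = α
    · subst h; simp
    · rw [if_neg h]
      split_ifs with hd
      · rw [coeff_monomial, if_neg fun h' => h (hα β hd h'.le)]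
      · simp
  | add f g hf hg => simp [hf, hg]

/-- The `K`-algebra map from a polynomial ring to the fiber cone that sends the variables to
the degree-one classes of a family of elements of the ideal. -/
def toFiberCone (I : Ideal (MvPolynomial σ K)) (g : τ → MvPolynomial σ K)
    (hg : ∀ i, g i ∈ I ^ 1) : MvPolynomial τ K →ₐ[K] FiberCone I :=
  (Ideal.Quotient.mkₐ K _).comp (ofGenerators I g hg)

theorem toFiberCone_X (I : Ideal (MvPolynomial σ K)) (g : τ → MvPolynomial σ K)
    (hg : ∀ i, g i ∈ I ^ 1) (i : τ) : toFiberCone I g hg (X i) = classOf I 1 ⟨g i, hg i⟩ := by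
  simp [toFiberCone, ofGenerators, classOf]

theorem toFiberCone_monomial (β : τ →₀ ℕ) (k : ℕ) (hk : β.degree = k)
    (h : monomial (Finsupp.linearCombination ℕ e β) (1 : K) ∈ I ^ k) :
    toFiberCone I _ hg (monomial β 1) = classOf I k ⟨_, h⟩ := by
  subst hk
  refine congrArg (Ideal.Quotient.mk _) (Subtype.ext ?_)
  exact ofGenerators_monomial hg β 1

theorem toFiberCone_monomial_eq_zero {α β : τ →₀ ℕ}
    (hd : β.degree = α.degree)
    (h : Finsupp.linearCombination ℕ e β < Finsupp.linearCombination ℕ e α) :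
    toFiberCone I _ hg (monomial α 1) = 0 := by
  classical
  obtain ⟨δ, hδ⟩ := exists_add_of_le h.le
  have hδ0 : δ ≠ 0 := by rintro rfl; simp [hδ] at h
  have hs : ofGenerators I _ hg (monomial α 1) =
      algebraMap (MvPolynomial σ K) (reesAlgebra I) (monomial δ 1) *
        ofGenerators I _ hg (monomial β 1) := by
    refine Subtype.ext ?_
    change _ = (Polynomial.C (monomial δ (1 : K))) * (ofGenerators I _ hg (monomial β 1) : Polynomial (MvPolynomial σ K))
    rw [ofGenerators_monomial, ofGenerators_monomial, Polynomial.C_mul_monomial, monomial_mul,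
      one_mul, hd, hδ, add_comm]
  change Ideal.Quotient.mk _ (ofGenerators I _ hg (monomial α 1)) = 0
  rw [hs, map_mul, mk_algebraMap_eq, constantCoeff_monomial, if_neg hδ0, map_zero, zero_mul]

theorem coeff_eq_zero_of_toFiberCone_eq_zero
    (hI : I = Ideal.span (Set.range fun i => monomial (e i) (1 : K))) {α : τ →₀ ℕ}
    (hα : IsRigidExponent e α) {f : MvPolynomial τ K} (hf : toFiberCone I _ hg f = 0) :
    coeff α f = 0 := by
  rw [← coeff_coeff_ofGenerators hg hα]
  exact coeff_coeff_eq_zero_of_mem_map_span_X hI hα (Ideal.Quotient.eq_zero_iff_mem.mp hf)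

/-- Members of `R` die by strict divisibility. Conversely, no rigid exponent occurs in the support
of a kernel element, so each exponent in the support lies above some member of `R`. -/
theorem ker_toFiberCone_eq_span_monomial
    (hI : I = Ideal.span (Set.range fun i => monomial (e i) (1 : K))) (R : Set (τ →₀ ℕ))
    (hR : ∀ ρ ∈ R, ∃ β : τ →₀ ℕ, β.degree = ρ.degree ∧
      Finsupp.linearCombination ℕ e β < Finsupp.linearCombination ℕ e ρ)
    (hS : ∀ α, (∀ ρ ∈ R, ¬ ρ ≤ α) → IsRigidExponent e α) :
    RingHom.ker (toFiberCone I _ hg) = Ideal.span ((fun ρ => monomial ρ (1 : K)) '' R) := by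
  refine le_antisymm (fun f hf => ?_) (Ideal.span_le.mpr ?_)
  · rw [mem_ideal_span_monomial_image]
    intro α hα
    by_contra! h
    exact mem_support_iff.mp hα (coeff_eq_zero_of_toFiberCone_eq_zero hg hI (hS α h) hf)
  · rintro _ ⟨ρ, hρ, rfl⟩
    obtain ⟨β, hd, hlt⟩ := hR ρ hρ
    exact toFiberCone_monomial_eq_zero hg hd hlt

theorem component_eq_span
    (hI : I = Ideal.span (Set.range fun i => monomial (e i) (1 : K))) (k : ℕ) :
    component I k = Submodule.span K
      ((fun β => toFiberCone I _ hg (monomial β 1)) '' {β | β.degree = k}) := by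
  refine le_antisymm ?_ (Submodule.span_le.mpr ?_)
  · rintro _ ⟨⟨f, hf⟩, rfl⟩
    have hf' : f ∈ I ^ k := hf
    rw [pow_eq_span_monomial_linearCombination hI] at hf'
    induction hf' using Submodule.span_induction with
    | mem f hf' =>
      obtain ⟨_, ⟨β, hβ, rfl⟩, rfl⟩ := hf'
      have hx : classOf I k ⟨_, hf⟩ = _ := (toFiberCone_monomial hg β k hβ hf).symm
      simp only [hx]
      exact Submodule.subset_span ⟨β, hβ, rfl⟩
    | zero =>
      have : (⟨0, hf⟩ : (I ^ k).restrictScalars K) = 0 := rfl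
      rw [this, map_zero]
      exact Submodule.zero_mem _
    | add f g hf₁ hg₁ ihf ihg =>
      have hf₂ : f ∈ (I ^ k).restrictScalars K := by
        rwa [Submodule.restrictScalars_mem, pow_eq_span_monomial_linearCombination hI]
      have hg₂ : g ∈ (I ^ k).restrictScalars K := by
        rwa [Submodule.restrictScalars_mem, pow_eq_span_monomial_linearCombination hI]
      have : (⟨f + g, hf⟩ : (I ^ k).restrictScalars K) = ⟨f, hf₂⟩ + ⟨g, hg₂⟩ := rfl
      rw [this, map_add]
      exact Submodule.add_mem _ (ihf hf₂) (ihg hg₂)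
    | smul r f hf₁ ih =>
      have hf₂ : f ∈ (I ^ k).restrictScalars K := by
        rwa [Submodule.restrictScalars_mem, pow_eq_span_monomial_linearCombination hI]
      have : classOf I k ⟨r • f, hf⟩ = constantCoeff r • classOf I k ⟨f, hf₂⟩ := by
        refine Eq.trans ?_ (Algebra.smul_def (R := K) (A := FiberCone I) (constantCoeff r)
          (classOf I k ⟨f, hf₂⟩)).symm
        rw [← mk_algebraMap_eq]
        change Ideal.Quotient.mk _ _ = Ideal.Quotient.mk _ _ * Ideal.Quotient.mk _ _
        rw [← map_mul]
        refine congrArg _ (Subtype.ext ?_)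
        exact (Polynomial.C_mul_monomial).symm
      rw [this]
      exact Submodule.smul_mem _ _ (ih hf₂)
  · rintro _ ⟨β, rfl, rfl⟩
    exact ⟨_, (toFiberCone_monomial hg β _ rfl
      (monomial_linearCombination_mem_pow hI β)).symm⟩

theorem toFiberCone_surjective
    (hI : I = Ideal.span (Set.range fun i => monomial (e i) (1 : K))) :
    Function.Surjective (toFiberCone I _ hg) := by
  intro x
  obtain ⟨f, rfl⟩ := Ideal.Quotient.mk_surjective x
  have hf : f = ∑ k ∈ (f : Polynomial (MvPolynomial σ K)).support,
      ⟨Polynomial.monomial k ((f : Polynomial (MvPolynomial σ K)).coeff k),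
        reesAlgebra.monomial_mem.mpr (f.2 k)⟩ := by
    refine Subtype.ext ?_
    rw [AddSubmonoidClass.coe_finsetSum]
    exact Polynomial.as_sum_support _
  rw [hf, map_sum]
  refine (toFiberCone I _ hg).range.sum_mem fun k _ => ?_
  have h : classOf I k ⟨_, f.2 k⟩ ∈ component I k := ⟨_, rfl⟩
  rw [component_eq_span hg hI] at h
  refine (Submodule.span_le (p := Subalgebra.toSubmodule (toFiberCone I _ hg).range)).mpr ?_ h
  rintro _ ⟨β, -, rfl⟩
  exact ⟨_, rfl⟩

/-- The standard monomials of degree `k` are independent because rigidity recovers their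
coefficients; all other monomials of degree `k` map to zero. -/
theorem finrank_component_eq_card
    (hI : I = Ideal.span (Set.range fun i => monomial (e i) (1 : K))) (R : Set (τ →₀ ℕ))
    (hR : ∀ ρ ∈ R, ∃ β : τ →₀ ℕ, β.degree = ρ.degree ∧
      Finsupp.linearCombination ℕ e β < Finsupp.linearCombination ℕ e ρ)
    (hS : ∀ α, (∀ ρ ∈ R, ¬ ρ ≤ α) → IsRigidExponent e α) (k : ℕ)
    {ι : Type*} [Fintype ι] (s : ι → τ →₀ ℕ) (hs : Function.Injective s)
    (hrange : ∀ α, α ∈ Set.range s ↔ α.degree = k ∧ ∀ ρ ∈ R, ¬ ρ ≤ α) :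
    Module.finrank K (component I k) = Fintype.card ι := by
  have hg : ∀ i, monomial (e i) (1 : K) ∈ I ^ 1 := fun i => by
    rw [pow_one, hI]
    exact Ideal.subset_span ⟨i, rfl⟩
  have hli : LinearIndependent K fun i => toFiberCone I _ hg (monomial (s i) 1) := by
    rw [Fintype.linearIndependent_iff]
    intro c hc i
    have h0 : toFiberCone I _ hg (∑ i, c i • monomial (s i) 1) = 0 := by
      simpa only [map_sum, map_smul] using hc
    have := coeff_eq_zero_of_toFiberCone_eq_zero hg hI (hS _ ((hrange (s i)).mp ⟨i, rfl⟩).2) h0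
    classical
    simpa [coeff_sum, coeff_monomial, hs.eq_iff] using this
  suffices h : component I k =
      Submodule.span K (Set.range fun i => toFiberCone I _ hg (monomial (s i) 1)) by
    rw [h, finrank_span_eq_card hli]
  rw [component_eq_span hg hI]
  refine le_antisymm (Submodule.span_le.mpr ?_) (Submodule.span_mono ?_)
  · rintro _ ⟨β, hβ, rfl⟩
    by_cases h : ∀ ρ ∈ R, ¬ ρ ≤ β
    · obtain ⟨i, rfl⟩ := (hrange β).mpr ⟨hβ, h⟩
      exact Submodule.subset_span ⟨i, rfl⟩
    · have : toFiberCone I _ hg (monomial β 1) = 0 := by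
        rw [← RingHom.mem_ker, ker_toFiberCone_eq_span_monomial hg hI R hR hS,
          mem_ideal_span_monomial_image]
        push Not at h
        intro β' hβ'
        rw [Finset.mem_singleton.mp (support_monomial_subset hβ')]
        exact h
      simp only [this]
      exact Submodule.zero_mem _
  · rintro _ ⟨i, rfl⟩
    exact ⟨s i, ((hrange _).mp ⟨i, rfl⟩).1, rfl⟩

end FiberCone

end MonomialFiberCone

/-! ### Cohen–Macaulayness of the two monomial quotients. -/

section QuotientOfFourVariables

open scoped Polynomial

variable {K : Type u} [Field K]

theorem isCohenMacaulayRing_of_ringEquiv (K : Type u) [Field K] {Q : Type*} {B : Type v} [CommRing Q] [CommRing B]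
    [Algebra K[X][X] Q] [Module.Free K[X][X] Q] [Module.Finite K[X][X] Q] (e : Q ≃+* B) :
    IsCohenMacaulayRing B := by
  let : Algebra K[X][X] B := (e.toRingHom.comp (algebraMap K[X][X] Q)).toAlgebra
  let l : Q ≃ₗ[K[X][X]] B :=
    { e with
      map_smul' := fun r x => by
        rw [Algebra.smul_def, Algebra.smul_def]
        exact map_mul e _ _ }
  have := Module.Free.of_equiv l
  have := Module.Finite.equiv l
  exact isCohenMacaulayRing_of_free (K := K) B

/-- The evaluation homomorphism `K[s][t] → S` at two elements of a `K`-algebra `S`. -/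
noncomputable def evalTwo {S : Type*} [CommRing S] [Algebra K S] (s t : S) : K[X][X] →+* S :=
  Polynomial.eval₂RingHom (Polynomial.aeval s : K[X] →ₐ[K] S).toRingHom t

theorem comp_evalTwo_eq {S E : Type*} [CommRing S] [Algebra K S] [CommRing E]
    [Algebra K[X][X] E] [Algebra K E] [IsScalarTower K K[X][X] E] {s t : S} (f : S →ₐ[K] E)
    (hs : f s = algebraMap K[X][X] E (Polynomial.C Polynomial.X))
    (ht : f t = algebraMap K[X][X] E Polynomial.X) :
    (f : S →+* E).comp (evalTwo s t) = algebraMap K[X][X] E := by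
  refine Polynomial.ringHom_ext' (Polynomial.ringHom_ext (fun c => ?_) ?_) ?_
  · have := IsScalarTower.algebraMap_apply K K[X][X] E c
    simpa [evalTwo] using this
  · simpa [evalTwo] using hs
  · simpa [evalTwo] using ht

/-- The two-branch criterion with `u = X 2`, `v = X 1` over `K[s][t]`. Hypotheses `h0` and `h3`
eliminate the other two variables; `y` and `w` are the coordinates of the two branches. -/
theorem isCohenMacaulayRing_of_two_branches {B : Type v} [CommRing B]
    {J : Ideal (MvPolynomial (Fin 4) K)} {s t : MvPolynomial (Fin 4) K} {α β : K[X][X]} {n : ℕ}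
    (e : (MvPolynomial (Fin 4) K ⧸ J) ≃+* B)
    (h0 : ∃ γ δ : K[X][X], X 0 = evalTwo s t γ + evalTwo s t δ * X 2)
    (h3 : ∃ γ δ : K[X][X], X 3 = evalTwo s t γ + evalTwo s t δ * X 1)
    (h2 : X 2 ^ (n + 1) - evalTwo s t α * X 2 ^ n ∈ J)
    (h1 : X 1 ^ (n + 1) - evalTwo s t β * X 1 ^ n ∈ J)
    (h21 : X 2 * X 1 - (evalTwo s t α * X 1 + evalTwo s t β * X 2 - evalTwo s t (α * β)) ∈ J)
    (y : Fin 4 → AdjoinRoot ((Polynomial.X - Polynomial.C α) * Polynomial.X ^ n))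
    (hyJ : ∀ f ∈ J, aeval (R := K) y f = 0)
    (hys : aeval (R := K) y s = algebraMap K[X][X] _ (Polynomial.C Polynomial.X))
    (hyt : aeval (R := K) y t = algebraMap K[X][X] _ Polynomial.X)
    (hy2 : y 2 = AdjoinRoot.root _) (hy1 : y 1 = algebraMap _ _ β)
    (w : Fin 4 → AdjoinRoot ((Polynomial.X - Polynomial.C β) * Polynomial.X ^ n))
    (hwJ : ∀ f ∈ J, aeval (R := K) w f = 0)
    (hws : aeval (R := K) w s = algebraMap K[X][X] _ (Polynomial.C Polynomial.X))
    (hwt : aeval (R := K) w t = algebraMap K[X][X] _ Polynomial.X)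
    (hw1 : w 1 = AdjoinRoot.root _) (hw2 : w 2 = algebraMap _ _ α) :
    IsCohenMacaulayRing B := by
  let : Algebra K[X][X] (MvPolynomial (Fin 4) K ⧸ J) :=
    ((Ideal.Quotient.mk J).comp (evalTwo s t)).toAlgebra
  have halg : ∀ a, algebraMap K[X][X] (MvPolynomial (Fin 4) K ⧸ J) a =
      Ideal.Quotient.mk J (evalTwo s t a) := fun _ => rfl
  let p : (MvPolynomial (Fin 4) K ⧸ J) →ₐ[K[X][X]]
      AdjoinRoot ((Polynomial.X - Polynomial.C α) * Polynomial.X ^ n) :=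
    { Ideal.Quotient.lift J (aeval (R := K) y).toRingHom hyJ with
      commutes' := fun a => RingHom.congr_fun (comp_evalTwo_eq (aeval (R := K) y) hys hyt) a }
  let q : (MvPolynomial (Fin 4) K ⧸ J) →ₐ[K[X][X]]
      AdjoinRoot ((Polynomial.X - Polynomial.C β) * Polynomial.X ^ n) :=
    { Ideal.Quotient.lift J (aeval (R := K) w).toRingHom hwJ with
      commutes' := fun a => RingHom.congr_fun (comp_evalTwo_eq (aeval (R := K) w) hws hwt) a }
  have hp : ∀ f, p (Ideal.Quotient.mk J f) = aeval y f := fun f => rfl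
  have hq : ∀ f, q (Ideal.Quotient.mk J f) = aeval w f := fun f => rfl
  have hgen : Algebra.adjoin K[X][X]
      {Ideal.Quotient.mk J (X 2 : MvPolynomial (Fin 4) K), Ideal.Quotient.mk J (X 1)} = ⊤ := by
    refine eq_top_iff.mpr fun x _ => ?_
    obtain ⟨f, rfl⟩ := Ideal.Quotient.mk_surjective x
    set S := Algebra.adjoin K[X][X]
      {Ideal.Quotient.mk J (X 2 : MvPolynomial (Fin 4) K), Ideal.Quotient.mk J (X 1)}
    have m2 : Ideal.Quotient.mk J (X 2) ∈ S := Algebra.subset_adjoin (Or.inl rfl)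
    have m1 : Ideal.Quotient.mk J (X 1) ∈ S := Algebra.subset_adjoin (Or.inr rfl)
    have mA : ∀ a, Ideal.Quotient.mk J (evalTwo s t a) ∈ S := fun a => S.algebraMap_mem a
    induction f using MvPolynomial.induction_on with
    | C c =>
      have := mA (Polynomial.C (Polynomial.C c))
      simpa [evalTwo] using this
    | add f g hf hg => rw [map_add]; exact S.add_mem (hf trivial) (hg trivial)
    | mul_X f i hf =>
      rw [map_mul]
      refine S.mul_mem (hf trivial) ?_
      fin_cases i
      · obtain ⟨γ, δ, h⟩ := h0
        change Ideal.Quotient.mk J (X 0) ∈ S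
        rw [h, map_add, map_mul]
        exact S.add_mem (mA _) (S.mul_mem (mA _) m2)
      · exact m1
      · exact m2
      · obtain ⟨γ, δ, h⟩ := h3
        change Ideal.Quotient.mk J (X 3) ∈ S
        rw [h, map_add, map_mul]
        exact S.add_mem (mA _) (S.mul_mem (mA _) m1)
  have hff := free_finite_of_two_branches (α := α) (β := β) (n := n) hgen
    (by
      rw [Algebra.smul_def, halg, ← map_pow, ← map_pow, ← map_mul]
      exact Ideal.Quotient.mk_eq_mk_iff_sub_mem _ _ |>.mpr h2)
    (by
      rw [Algebra.smul_def, halg, ← map_pow, ← map_pow, ← map_mul]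
      exact Ideal.Quotient.mk_eq_mk_iff_sub_mem _ _ |>.mpr h1)
    (by
      rw [Algebra.smul_def, Algebra.smul_def, halg, halg, halg]
      simp only [← map_mul (Ideal.Quotient.mk J), ← map_add, ← map_sub]
      exact Ideal.Quotient.mk_eq_mk_iff_sub_mem _ _ |>.mpr h21)
    p (by rw [hp, aeval_X, hy2]) (by rw [hp, aeval_X, hy1])
    q (by rw [hq, aeval_X, hw1]) (by rw [hq, aeval_X, hw2])
  have := hff.1
  have := hff.2
  exact isCohenMacaulayRing_of_ringEquiv K e

theorem forall_mem_span_aeval_eq_zero {E : Type*} [CommRing E] [Algebra K E]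
    {S : Set (MvPolynomial (Fin 4) K)} (y : Fin 4 → E) (h : ∀ f ∈ S, aeval (R := K) y f = 0) :
    ∀ f ∈ Ideal.span S, aeval (R := K) y f = 0 :=
  fun _ hf => (Ideal.span_le (I := RingHom.ker (aeval (R := K) y))).mpr h hf

theorem aeval_eq_zero_of_mem_relIdealA {E : Type*} [CommRing E] [Algebra K E] (y : Fin 4 → E)
    (h12 : y 1 * y 2 = 0) (h11 : y 1 ^ 2 = 0) (h22 : y 2 ^ 2 = 0) :
    ∀ f ∈ relIdealA K, aeval (R := K) y f = 0 := by
  refine forall_mem_span_aeval_eq_zero y ?_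
  rintro f (rfl | rfl | rfl)
  · rw [map_mul, aeval_X, aeval_X, h12]
  · rw [map_pow, aeval_X, h11]
  · rw [map_pow, aeval_X, h22]

theorem aeval_eq_zero_of_mem_relIdealB {E : Type*} [CommRing E] [Algebra K E] {n : ℕ}
    (y : Fin 4 → E) (h02 : y 0 * y 2 ^ n = 0) (h13 : y 1 ^ n * y 3 = 0) (h03 : y 0 * y 3 = 0) :
    ∀ f ∈ relIdealB K (n + 1), aeval (R := K) y f = 0 := by
  refine forall_mem_span_aeval_eq_zero y ?_
  rintro f (rfl | rfl | rfl)
  · rw [Nat.add_sub_cancel, map_mul, map_pow, aeval_X, aeval_X, h02]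
  · rw [Nat.add_sub_cancel, map_mul, map_pow, aeval_X, aeval_X, h13]
  · rw [map_mul, aeval_X, aeval_X, h03]

theorem AdjoinRoot.root_mul_root_pow {A : Type*} [CommRing A] (α : A) (n : ℕ) :
    (algebraMap A _ α - AdjoinRoot.root ((Polynomial.X - Polynomial.C α) * Polynomial.X ^ n)) *
      AdjoinRoot.root ((Polynomial.X - Polynomial.C α) * Polynomial.X ^ n) ^ n = 0 := by
  have h := AdjoinRoot.mk_self (f := (Polynomial.X - Polynomial.C α) * Polynomial.X ^ n)
  simp only [map_mul, map_sub, map_pow, AdjoinRoot.mk_X, AdjoinRoot.mk_C] at h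
  rw [← neg_eq_zero, ← neg_mul, neg_sub]
  exact h

theorem isCohenMacaulayRing_of_equiv_relIdealA {B : Type v} [CommRing B]
    (e : (MvPolynomial (Fin 4) K ⧸ relIdealA K) ≃+* B) : IsCohenMacaulayRing B := by
  have m12 : X 1 * X 2 ∈ relIdealA K := Ideal.subset_span (by simp)
  have m11 : X 1 ^ 2 ∈ relIdealA K := Ideal.subset_span (by simp)
  have m22 : X 2 ^ 2 ∈ relIdealA K := Ideal.subset_span (by simp)
  have hr : AdjoinRoot.root
      ((Polynomial.X - Polynomial.C (0 : K[X][X])) * Polynomial.X ^ 1) ^ 2 = 0 := by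
    have h := AdjoinRoot.root_mul_root_pow (0 : K[X][X]) 1
    rwa [RingHom.map_zero (algebraMap _ _), zero_sub, neg_mul, neg_eq_zero, ← pow_succ'] at h
  -- With `α = β = 0` and `n = 1`, the three relations are `z₃² = 0`, `z₂² = 0` and `z₂z₃ = 0`.
  refine isCohenMacaulayRing_of_two_branches (α := 0) (β := 0) (n := 1) (s := X 0) (t := X 3) e
    ⟨Polynomial.C Polynomial.X, 0, by simp [evalTwo]⟩ ⟨Polynomial.X, 0, by simp [evalTwo]⟩
    (by simpa using m22) (by simpa using m11) (by simpa [mul_comm] using m12)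
    ![algebraMap K[X][X] _ (Polynomial.C Polynomial.X), 0, AdjoinRoot.root _,
      algebraMap K[X][X] _ Polynomial.X]
    (aeval_eq_zero_of_mem_relIdealA _ (zero_mul _) (zero_pow two_ne_zero) hr)
    (by simp) (by simp) rfl (by simp)
    ![algebraMap K[X][X] _ (Polynomial.C Polynomial.X), AdjoinRoot.root _, 0,
      algebraMap K[X][X] _ Polynomial.X]
    (aeval_eq_zero_of_mem_relIdealA _ (mul_zero _) hr (zero_pow two_ne_zero))
    (by simp) (by simp) rfl (by simp)

theorem isCohenMacaulayRing_of_equiv_relIdealB {B : Type v} [CommRing B] {n : ℕ}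
    (e : (MvPolynomial (Fin 4) K ⧸ relIdealB K (n + 1)) ≃+* B) : IsCohenMacaulayRing B := by
  have m02 : X 0 * X 2 ^ n ∈ relIdealB K (n + 1) := Ideal.subset_span (by simp)
  have m13 : X 1 ^ n * X 3 ∈ relIdealB K (n + 1) := Ideal.subset_span (by simp)
  have m03 : X 0 * X 3 ∈ relIdealB K (n + 1) := Ideal.subset_span (by simp)
  have hs : evalTwo (X 0 + X 2 : MvPolynomial (Fin 4) K) (X 3 + X 1)
      (Polynomial.C Polynomial.X : K[X][X]) = X 0 + X 2 := by simp [evalTwo]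
  have ht : evalTwo (X 0 + X 2 : MvPolynomial (Fin 4) K) (X 3 + X 1) (Polynomial.X : K[X][X]) =
      X 3 + X 1 := by
    simp [evalTwo]
  have hr := AdjoinRoot.root_mul_root_pow (Polynomial.C Polynomial.X : K[X][X]) n
  have hr' := AdjoinRoot.root_mul_root_pow (Polynomial.X : K[X][X]) n
  -- Here `z₃ - s = -z₁` and `z₂ - t = -z₄`, so the three generators of the ideal become, up to
  -- sign, the two-branch relations with `α = s`, `β = t`.
  refine isCohenMacaulayRing_of_two_branches (α := Polynomial.C Polynomial.X)
    (β := Polynomial.X) (n := n) (s := X 0 + X 2) (t := X 3 + X 1) e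
    ⟨Polynomial.C Polynomial.X, -1, by rw [hs, RingHom.map_neg, RingHom.map_one]; ring⟩
    ⟨Polynomial.X, -1, by rw [ht, RingHom.map_neg, RingHom.map_one]; ring⟩
    (by rw [hs]; convert neg_mem m02 using 1; ring)
    (by rw [ht]; convert neg_mem m13 using 1; ring)
    (by rw [(evalTwo _ _).map_mul, hs, ht]; convert m03 using 1; ring)
    ![algebraMap K[X][X] _ (Polynomial.C Polynomial.X) - AdjoinRoot.root _,
      algebraMap K[X][X] _ Polynomial.X,
      AdjoinRoot.root _, 0]
    (aeval_eq_zero_of_mem_relIdealB _ hr (mul_zero _) (mul_zero _)) (by simp) (by simp) rfl rfl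
    ![0, AdjoinRoot.root _, algebraMap K[X][X] _ (Polynomial.C Polynomial.X),
      algebraMap K[X][X] _ Polynomial.X - AdjoinRoot.root _]
    (aeval_eq_zero_of_mem_relIdealB _ (zero_mul _) ((mul_comm _ _).trans hr') (zero_mul _))
    (by simp) (by simp) rfl rfl

end QuotientOfFourVariables

/-! ### Strict divisibility and rigidity for the four generators. -/

noncomputable section SymmetricIdeal

/-- The exponent vectors of the monomials `x^c, x^b y^a, x^a y^b, y^c`. -/
def symmExponent (a b c : ℕ) (i : Fin 4) : Fin 2 →₀ ℕ :=
  Finsupp.single 0 (![c, b, a, 0] i) + Finsupp.single 1 (![0, a, b, c] i)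

theorem symmGen_eq_monomial (K : Type u) [Field K] (a b c : ℕ) :
    symmGen K a b c = fun i => monomial (symmExponent a b c i) 1 := by
  funext i
  fin_cases i <;> simp [symmGen, symmExponent, X_pow_eq_monomial, monomial_mul]

theorem symmIdeal_eq_span_monomial (K : Type u) [Field K] (a b c : ℕ) :
    symmIdeal K a b c = Ideal.span (Set.range fun i => monomial (symmExponent a b c i) (1 : K)) := by
  rw [symmIdeal, symmGen_eq_monomial]

theorem monomial_symmExponent_mem (K : Type u) [Field K] (a b c : ℕ) (i : Fin 4) :
    monomial (symmExponent a b c i) (1 : K) ∈ symmIdeal K a b c ^ 1 := by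
  have := symmGen_mem K a b c i
  rwa [symmGen_eq_monomial] at this

theorem degree_fin_four (α : Fin 4 →₀ ℕ) : α.degree = α 0 + α 1 + α 2 + α 3 := by
  rw [Finsupp.degree_eq_sum, Fin.sum_univ_four]

theorem linearCombination_symmExponent_zero (a b c : ℕ) (α : Fin 4 →₀ ℕ) :
    Finsupp.linearCombination ℕ (symmExponent a b c) α 0 = c * α 0 + b * α 1 + a * α 2 := by
  rw [Finsupp.linearCombination_apply, Finsupp.sum_fintype _ _ (by simp), Fin.sum_univ_four]
  simp [symmExponent, mul_comm]

theorem linearCombination_symmExponent_one (a b c : ℕ) (α : Fin 4 →₀ ℕ) :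
    Finsupp.linearCombination ℕ (symmExponent a b c) α 1 = a * α 1 + b * α 2 + c * α 3 := by
  rw [Finsupp.linearCombination_apply, Finsupp.sum_fintype _ _ (by simp), Fin.sum_univ_four]
  simp [symmExponent, mul_comm]

theorem linearCombination_symmExponent_le_iff (a b c : ℕ) (α β : Fin 4 →₀ ℕ) :
    Finsupp.linearCombination ℕ (symmExponent a b c) β ≤
      Finsupp.linearCombination ℕ (symmExponent a b c) α ↔
    c * β 0 + b * β 1 + a * β 2 ≤ c * α 0 + b * α 1 + a * α 2 ∧
      a * β 1 + b * β 2 + c * β 3 ≤ a * α 1 + b * α 2 + c * α 3 := by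
  rw [Finsupp.le_def, Fin.forall_fin_two, linearCombination_symmExponent_zero,
    linearCombination_symmExponent_zero, linearCombination_symmExponent_one,
    linearCombination_symmExponent_one]

/-- The exponent vector with the given four entries. -/
def exponent (i j k l : ℕ) : Fin 4 →₀ ℕ := Finsupp.equivFunOnFinite.symm ![i, j, k, l]

@[simp] theorem exponent_zero (i j k l : ℕ) : exponent i j k l 0 = i := rfl
@[simp] theorem exponent_one (i j k l : ℕ) : exponent i j k l 1 = j := rfl
@[simp] theorem exponent_two (i j k l : ℕ) : exponent i j k l 2 = k := rfl
@[simp] theorem exponent_three (i j k l : ℕ) : exponent i j k l 3 = l := rfl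

theorem exponent_ext {α β : Fin 4 →₀ ℕ} (h0 : α 0 = β 0) (h1 : α 1 = β 1) (h2 : α 2 = β 2)
    (h3 : α 3 = β 3) : α = β := by
  ext i
  fin_cases i <;> assumption

theorem exponent_le_iff (i j k l : ℕ) (α : Fin 4 →₀ ℕ) :
    exponent i j k l ≤ α ↔ i ≤ α 0 ∧ j ≤ α 1 ∧ k ≤ α 2 ∧ l ≤ α 3 := by
  rw [Finsupp.le_def]
  constructor
  · exact fun h => ⟨h 0, h 1, h 2, h 3⟩
  · rintro ⟨h0, h1, h2, h3⟩ i
    fin_cases i <;> assumption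

theorem monomial_exponent (K : Type u) [Field K] (i j k l : ℕ) :
    monomial (exponent i j k l) (1 : K) = X 0 ^ i * X 1 ^ j * X 2 ^ k * X 3 ^ l := by
  rw [monomial_eq, Finsupp.prod_fintype _ _ (by simp), Fin.prod_univ_four]
  simp

/-- The exponents of the generators of the ideal `(z₂z₃, z₂², z₃²)`. -/
def relExponentsA : Set (Fin 4 →₀ ℕ) := {exponent 0 1 1 0, exponent 0 2 0 0, exponent 0 0 2 0}

/-- The exponents of the generators of the ideal `(z₁z₃ⁿ, z₂ⁿz₄, z₁z₄)`. -/
def relExponentsB (n : ℕ) : Set (Fin 4 →₀ ℕ) :=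
  {exponent 1 0 n 0, exponent 0 n 0 1, exponent 1 0 0 1}

theorem relIdealA_eq_span_monomial (K : Type u) [Field K] :
    relIdealA K = Ideal.span ((fun ρ => monomial ρ (1 : K)) '' relExponentsA) := by
  simp [relIdealA, relExponentsA, Set.image_insert_eq, monomial_exponent]

theorem relIdealB_eq_span_monomial (K : Type u) [Field K] (n : ℕ) :
    relIdealB K (n + 1) = Ideal.span ((fun ρ => monomial ρ (1 : K)) '' relExponentsB n) := by
  simp [relIdealB, relExponentsB, Set.image_insert_eq, monomial_exponent]

theorem forall_relExponentsA_not_le_iff (α : Fin 4 →₀ ℕ) :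
    (∀ ρ ∈ relExponentsA, ¬ ρ ≤ α) ↔ α 1 + α 2 ≤ 1 := by
  simp only [relExponentsA, Set.mem_insert_iff, Set.mem_singleton_iff, forall_eq_or_imp,
    forall_eq, exponent_le_iff]
  omega

theorem forall_relExponentsB_not_le_iff (n : ℕ) (α : Fin 4 →₀ ℕ) :
    (∀ ρ ∈ relExponentsB n, ¬ ρ ≤ α) ↔ (α 0 = 0 ∨ α 2 < n) ∧ (α 1 < n ∨ α 3 = 0) ∧
      (α 0 = 0 ∨ α 3 = 0) := by
  simp only [relExponentsB, Set.mem_insert_iff, Set.mem_singleton_iff, forall_eq_or_imp,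
    forall_eq, exponent_le_iff]
  omega

theorem exists_lt_of_mem_relExponentsA {a b c : ℕ} (hab : a < b) (hac : c ≤ 2 * a) :
    ∀ ρ ∈ relExponentsA, ∃ β : Fin 4 →₀ ℕ, β.degree = ρ.degree ∧
      Finsupp.linearCombination ℕ (symmExponent a b c) β <
        Finsupp.linearCombination ℕ (symmExponent a b c) ρ := by
  intro ρ hρ
  refine ⟨exponent 1 0 0 1, ?_⟩
  simp only [relExponentsA, Set.mem_insert_iff, Set.mem_singleton_iff] at hρ
  rcases hρ with rfl | rfl | rfl <;>
  · simp only [degree_fin_four, lt_iff_le_not_ge, linearCombination_symmExponent_le_iff,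
      exponent_zero, exponent_one, exponent_two, exponent_three, true_and]
    exact ⟨⟨by omega, by omega⟩, fun h => by obtain ⟨h1, h2⟩ := h; omega⟩

theorem exists_lt_of_mem_relExponentsB {a b c n : ℕ} (hab : a < b)
    (hn : b ≤ (n + 1) * (b - a)) (hc : (n + 1) * (b - a) + a < c) :
    ∀ ρ ∈ relExponentsB n, ∃ β : Fin 4 →₀ ℕ, β.degree = ρ.degree ∧
      Finsupp.linearCombination ℕ (symmExponent a b c) β <
        Finsupp.linearCombination ℕ (symmExponent a b c) ρ := by
  obtain ⟨d, rfl⟩ := Nat.exists_eq_add_of_lt hab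
  have hd : a + d + 1 - a = d + 1 := by omega
  rw [hd] at hn hc
  intro ρ hρ
  simp only [relExponentsB, Set.mem_insert_iff, Set.mem_singleton_iff] at hρ
  rcases hρ with rfl | rfl | rfl
  -- `u₂^(n+1)` divides `u₁u₃^n`: the `y`-degrees compare by `hn`, and the `x`-degrees compare
  -- strictly by `hc`.
  · refine ⟨exponent 0 (n + 1) 0 0, ?_⟩
    simp only [degree_fin_four, lt_iff_le_not_ge, linearCombination_symmExponent_le_iff,
      exponent_zero, exponent_one, exponent_two, exponent_three]
    refine ⟨by omega, ⟨by nlinarith, by nlinarith⟩, fun h => ?_⟩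
    nlinarith [h.1]
  · refine ⟨exponent 0 0 (n + 1) 0, ?_⟩
    simp only [degree_fin_four, lt_iff_le_not_ge, linearCombination_symmExponent_le_iff,
      exponent_zero, exponent_one, exponent_two, exponent_three]
    refine ⟨by omega, ⟨by nlinarith, by nlinarith⟩, fun h => ?_⟩
    nlinarith [h.2]
  · refine ⟨exponent 0 1 1 0, ?_⟩
    simp only [degree_fin_four, lt_iff_le_not_ge, linearCombination_symmExponent_le_iff,
      exponent_zero, exponent_one, exponent_two, exponent_three, true_and]
    exact ⟨⟨by omega, by omega⟩, fun h => by obtain ⟨h1, h2⟩ := h; omega⟩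

theorem eq_of_symmExponent_le_of_add_le_one {a b c α0 α1 α2 α3 β0 β1 β2 β3 : ℕ} (hab : a < b)
    (hbc : b < c) (hac : c ≤ 2 * a) (hα : α1 + α2 ≤ 1)
    (hd : β0 + β1 + β2 + β3 = α0 + α1 + α2 + α3)
    (hx : c * β0 + b * β1 + a * β2 ≤ c * α0 + b * α1 + a * α2)
    (hy : a * β1 + b * β2 + c * β3 ≤ a * α1 + b * α2 + c * α3) :
    β0 = α0 ∧ β1 = α1 ∧ β2 = α2 ∧ β3 = α3 := by
  -- Total degrees are compared: `u₁`, `u₄` have degree `c`, whereas `u₂`, `u₃` have the larger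
  -- degree `a + b`.
  have key : β1 + β2 ≤ α1 + α2 := by
    obtain ⟨e, he⟩ := Nat.exists_eq_add_of_lt (show c < a + b by omega)
    have h1 : c * (β0 + β1 + β2 + β3) = c * (α0 + α1 + α2 + α3) := by rw [hd]
    have h2 : (a + b) * (β1 + β2) + c * (β0 + β3) ≤
      (a + b) * (α1 + α2) + c * (α0 + α3) := by linarith
    rw [he] at h2
    have h3 : (e + 1) * (β1 + β2) ≤ (e + 1) * (α1 + α2) := by linarith
    exact Nat.le_of_mul_le_mul_left h3 (by omega)
  have cancel : ∀ p q : ℕ, c * p < c * q + c → p ≤ q := fun p q h => by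
    have : c * p < c * (q + 1) := by linarith
    exact Nat.lt_succ_iff.mp (Nat.lt_of_mul_lt_mul_left this)
  have hα' : α1 = 0 ∧ α2 = 0 ∨ α1 = 1 ∧ α2 = 0 ∨ α1 = 0 ∧ α2 = 1 := by omega
  have hβ' : β1 = 0 ∧ β2 = 0 ∨ β1 = 1 ∧ β2 = 0 ∨ β1 = 0 ∧ β2 = 1 := by omega
  have h0 : β0 ≤ α0 := by
    apply cancel
    rcases hα' with ⟨rfl, rfl⟩ | ⟨rfl, rfl⟩ | ⟨rfl, rfl⟩ <;>
      rcases hβ' with ⟨rfl, rfl⟩ | ⟨rfl, rfl⟩ | ⟨rfl, rfl⟩ <;> omega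
  have h3 : β3 ≤ α3 := by
    apply cancel
    rcases hα' with ⟨rfl, rfl⟩ | ⟨rfl, rfl⟩ | ⟨rfl, rfl⟩ <;>
      rcases hβ' with ⟨rfl, rfl⟩ | ⟨rfl, rfl⟩ | ⟨rfl, rfl⟩ <;> omega
  obtain rfl : β0 = α0 := by omega
  obtain rfl : β3 = α3 := by omega
  rcases hα' with ⟨rfl, rfl⟩ | ⟨rfl, rfl⟩ | ⟨rfl, rfl⟩ <;>
    rcases hβ' with ⟨rfl, rfl⟩ | ⟨rfl, rfl⟩ | ⟨rfl, rfl⟩ <;> omega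

theorem isRigidExponent_of_add_le_one {a b c : ℕ} (hab : a < b) (hbc : b < c)
    (hac : c ≤ 2 * a) {α : Fin 4 →₀ ℕ} (hα : α 1 + α 2 ≤ 1) :
    IsRigidExponent (symmExponent a b c) α := by
  intro β hd hle
  rw [linearCombination_symmExponent_le_iff] at hle
  rw [degree_fin_four, degree_fin_four] at hd
  obtain ⟨h0, h1, h2, h3⟩ := eq_of_symmExponent_le_of_add_le_one hab hbc hac hα hd hle.1 hle.2
  exact exponent_ext h0 h1 h2 h3

/-- The reversal of an exponent vector of length four. -/
def revExponent (α : Fin 4 →₀ ℕ) : Fin 4 →₀ ℕ := exponent (α 3) (α 2) (α 1) (α 0)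

/-- Exchanging `x` and `y` reverses the order of the generators. -/
theorem IsRigidExponent.of_revExponent {a b c : ℕ} {α : Fin 4 →₀ ℕ}
    (h : IsRigidExponent (symmExponent a b c) (revExponent α)) :
    IsRigidExponent (symmExponent a b c) α := by
  intro β hd hle
  have := h (revExponent β) ?_ ?_
  · have h' := DFunLike.congr_fun this
    exact exponent_ext (h' 3) (h' 2) (h' 1) (h' 0)
  · simp only [degree_fin_four, revExponent, exponent_zero, exponent_one, exponent_two,
      exponent_three] at hd ⊢
    omega
  · simp only [linearCombination_symmExponent_le_iff, revExponent, exponent_zero, exponent_one,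
      exponent_two, exponent_three] at hle ⊢
    omega

/-- As `a + b < c`, total degrees give `β0 + β3 ≤ α0`; let `t` be the difference. Subtracting `a`
times the number of factors from the `y`-degrees gives `hy'`. If `α2 < n`, its right side is less
than `a` because `n(b - a) < b`, so `β3 + t = 0`; if `α0 = 0` this is immediate. The remaining
entries are then compared separately. -/
theorem eq_of_symmExponent_le {a b c n α0 α1 α2 β0 β1 β2 β3 : ℕ} (hab : a < b)
    (habc : a + b < c) (hn : n * (b - a) < b) (hα : α0 = 0 ∨ α2 < n)
    (hd : β0 + β1 + β2 + β3 = α0 + α1 + α2)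
    (hx : c * β0 + b * β1 + a * β2 ≤ c * α0 + b * α1 + a * α2)
    (hy : a * β1 + b * β2 + c * β3 ≤ a * α1 + b * α2) :
    β0 = α0 ∧ β1 = α1 ∧ β2 = α2 ∧ β3 = 0 := by
  obtain ⟨d, rfl⟩ := Nat.exists_eq_add_of_lt hab
  obtain ⟨e, rfl⟩ := Nat.exists_eq_add_of_lt habc
  rw [show a + d + 1 - a = d + 1 by omega] at hn
  have hdeg : (e + 1) * (β0 + β3) ≤ (e + 1) * α0 := by
    have : (a + (a + d + 1)) * (β0 + β1 + β2 + β3) = (a + (a + d + 1)) * (α0 + α1 + α2) := by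
      rw [hd]
    linarith
  have hdeg' : β0 + β3 ≤ α0 := Nat.le_of_mul_le_mul_left hdeg (by omega)
  obtain ⟨t, rfl⟩ := Nat.exists_eq_add_of_le hdeg'
  have hy' : a * (β3 + t) + (d + 1) * β2 + (a + d + 1 + e + 1) * β3 ≤ (d + 1) * α2 := by
    have : a * (β0 + β1 + β2 + β3) = a * (β0 + β3 + t + α1 + α2) := by rw [hd]
    linarith
  have h30 : β3 + t = 0 := by
    rcases hα with h | h
    · omega
    · by_contra h0
      have h1 : a * 1 ≤ a * (β3 + t) := Nat.mul_le_mul_left a (by omega)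
      have h2 : (α2 + 1) * (d + 1) ≤ n * (d + 1) := Nat.mul_le_mul_right _ h
      linarith [Nat.zero_le ((d + 1) * β2), Nat.zero_le ((a + d + 1 + e + 1) * β3)]
  obtain ⟨rfl, rfl⟩ : β3 = 0 ∧ t = 0 := by omega
  have h2 : β2 ≤ α2 := by
    refine Nat.le_of_mul_le_mul_left (?_ : (d + 1) * β2 ≤ (d + 1) * α2) (Nat.succ_pos d)
    linarith
  have h1 : β1 ≤ α1 := by
    refine Nat.le_of_mul_le_mul_left (?_ : (d + 1) * β1 ≤ (d + 1) * α1) (Nat.succ_pos d)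
    have : a * (β0 + β1 + β2 + 0) = a * (β0 + 0 + 0 + α1 + α2) := by rw [hd]
    linarith
  omega

theorem isRigidExponent_of_three_eq_zero {a b c n : ℕ} (hab : a < b)
    (habc : a + b < c) (hn : n * (b - a) < b) {α : Fin 4 →₀ ℕ} (h3 : α 3 = 0)
    (hα : α 0 = 0 ∨ α 2 < n) : IsRigidExponent (symmExponent a b c) α := by
  intro β hd hle
  rw [linearCombination_symmExponent_le_iff, h3, mul_zero, add_zero] at hle
  rw [degree_fin_four, degree_fin_four, h3, add_zero] at hd
  obtain ⟨h0', h1', h2', h3'⟩ := eq_of_symmExponent_le hab habc hn hα hd hle.1 hle.2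
  exact exponent_ext h0' h1' h2' (h3'.trans h3.symm)

theorem isRigidExponent_of_forall_not_le {a b c n : ℕ} (hab : a < b)
    (habc : a + b < c) (hn : n * (b - a) < b) {α : Fin 4 →₀ ℕ}
    (hα : ∀ ρ ∈ relExponentsB n, ¬ ρ ≤ α) : IsRigidExponent (symmExponent a b c) α := by
  rw [forall_relExponentsB_not_le_iff] at hα
  obtain ⟨h1, h2, h3 | h3⟩ := hα
  · exact (isRigidExponent_of_three_eq_zero (α := revExponent α) hab habc hn h3
      h2.symm).of_revExponent
  · exact isRigidExponent_of_three_eq_zero hab habc hn h3 h1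

end SymmetricIdeal

/-! ### Hilbert series and enumeration of the standard monomials. -/

noncomputable section SymmetricFiberCone

/-- The coefficient of `X ^ k` in `X ^ (l + 1) / (1 - X) ^ 2` is `k - l`; truncated subtraction
gives the correct value 0 when `k ≤ l`. -/
theorem coeff_one_add_mul_inv_one_sub_X_sq (n k : ℕ) :
    PowerSeries.coeff k ((1 + 2 * ∑ i ∈ Finset.Icc 1 n, PowerSeries.X ^ i) *
      ((1 - PowerSeries.X : PowerSeries ℚ) ^ 2)⁻¹) =
      ((k + 1 + 2 * ∑ l ∈ Finset.range n, (k - l) : ℕ) : ℚ) := by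
  have hinv : ((1 - PowerSeries.X : PowerSeries ℚ) ^ 2)⁻¹ =
      PowerSeries.mk fun m => ((m + 1 : ℕ) : ℚ) := by
    rw [eq_comm, PowerSeries.eq_inv_iff_mul_eq_one (by simp)]
    simpa [add_comm] using PowerSeries.mk_add_choose_mul_one_sub_pow_eq_one ℚ 1
  rw [hinv, add_mul, one_mul, mul_assoc, Finset.sum_mul, map_add, PowerSeries.coeff_mk]
  have h2 : (2 : PowerSeries ℚ) = PowerSeries.C 2 := (map_ofNat PowerSeries.C 2).symm
  rw [h2, PowerSeries.coeff_C_mul, map_sum]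
  have hsum : ∑ i ∈ Finset.Icc 1 n, PowerSeries.coeff k
      (PowerSeries.X ^ i * PowerSeries.mk fun m => ((m + 1 : ℕ) : ℚ)) =
      ((∑ l ∈ Finset.range n, (k - l) : ℕ) : ℚ) := by
    induction n with
    | zero => simp
    | succ n ih =>
      rw [Finset.sum_Icc_succ_top (by omega), ih, Finset.sum_range_succ,
        PowerSeries.coeff_X_pow_mul', Nat.cast_add]
      congr 1
      split_ifs with h
      · rw [PowerSeries.coeff_mk]
        congr 1
        omega
      · rw [Nat.sub_eq_zero_of_le (by omega), Nat.cast_zero]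
  rw [hsum]
  push_cast
  ring

theorem exists_algEquiv_symmClass {K : Type u} [Field K] {a b c : ℕ} (R : Set (Fin 4 →₀ ℕ))
    (hR : ∀ ρ ∈ R, ∃ β : Fin 4 →₀ ℕ, β.degree = ρ.degree ∧
      Finsupp.linearCombination ℕ (symmExponent a b c) β <
        Finsupp.linearCombination ℕ (symmExponent a b c) ρ)
    (hS : ∀ α, (∀ ρ ∈ R, ¬ ρ ≤ α) → IsRigidExponent (symmExponent a b c) α)
    (J : Ideal (MvPolynomial (Fin 4) K))
    (hJ : J = Ideal.span ((fun ρ => monomial ρ (1 : K)) '' R)) :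
    ∃ e : (MvPolynomial (Fin 4) K ⧸ J) ≃ₐ[K] FiberCone (symmIdeal K a b c),
      ∀ i, e (Ideal.Quotient.mk _ (X i)) = symmClass K a b c i := by
  have hI := symmIdeal_eq_span_monomial K a b c
  have hg := monomial_symmExponent_mem K a b c
  have hker := FiberCone.ker_toFiberCone_eq_span_monomial hg hI R hR hS
  refine ⟨(Ideal.quotientEquivAlgOfEq K (hJ.trans hker.symm)).trans
    (Ideal.quotientKerAlgEquivOfSurjective (FiberCone.toFiberCone_surjective hg hI)), fun i => ?_⟩
  refine (FiberCone.toFiberCone_X _ _ hg i).trans ?_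
  refine congrArg (FiberCone.classOf (symmIdeal K a b c) 1) (Subtype.ext ?_)
  exact (congrFun (symmGen_eq_monomial K a b c) i).symm

/-- Enumeration of the exponents of degree `k` that are not divisible by a generator of
`(z₂z₃, z₂², z₃²)`. -/
def standardExponentA (k : ℕ) : Fin (k + 1) ⊕ Fin k ⊕ Fin k → Fin 4 →₀ ℕ
  | .inl t => exponent t 0 0 (k - t)
  | .inr (.inl t) => exponent t 1 0 (k - 1 - t)
  | .inr (.inr t) => exponent t 0 1 (k - 1 - t)

theorem standardExponentA_injective (k : ℕ) : Function.Injective (standardExponentA k) := by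
  rintro (s | s | s) (t | t | t) h <;>
  · have h0 := DFunLike.congr_fun h 0
    have h1 := DFunLike.congr_fun h 1
    have h2 := DFunLike.congr_fun h 2
    simp only [standardExponentA, exponent_zero, exponent_one, exponent_two] at h0 h1 h2
    first
    | omega
    | rw [Fin.ext h0]

theorem mem_range_standardExponentA_iff (k : ℕ) (α : Fin 4 →₀ ℕ) :
    α ∈ Set.range (standardExponentA k) ↔ α.degree = k ∧ ∀ ρ ∈ relExponentsA, ¬ ρ ≤ α := by
  rw [forall_relExponentsA_not_le_iff, degree_fin_four]
  constructor
  · rintro ⟨t | t | t, rfl⟩ <;>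
    · have := t.2
      simp only [standardExponentA, exponent_zero, exponent_one, exponent_two, exponent_three]
      omega
  · rintro ⟨hd, h⟩
    obtain ⟨h1, h2⟩ | ⟨h1, h2⟩ | ⟨h1, h2⟩ :
      α 1 = 0 ∧ α 2 = 0 ∨ α 1 = 1 ∧ α 2 = 0 ∨ α 1 = 0 ∧ α 2 = 1 := by omega
    · exact ⟨.inl ⟨α 0, by omega⟩, exponent_ext rfl h1.symm h2.symm
        (show k - α 0 = α 3 by omega)⟩
    · exact ⟨.inr (.inl ⟨α 0, by omega⟩), exponent_ext rfl h1.symm h2.symm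
        (show k - 1 - α 0 = α 3 by omega)⟩
    · exact ⟨.inr (.inr ⟨α 0, by omega⟩), exponent_ext rfl h1.symm h2.symm
        (show k - 1 - α 0 = α 3 by omega)⟩

/-- Enumeration of the exponents of degree `k` that are not divisible by a generator of
`(z₁z₃ⁿ, z₂ⁿz₄, z₁z₄)`. -/
def standardExponentB (n k : ℕ) :
    Fin (k + 1) ⊕ (Σ l : Fin n, Fin (k - l)) ⊕ (Σ l : Fin n, Fin (k - l)) → Fin 4 →₀ ℕ
  | .inl t => exponent 0 t (k - t) 0
  | .inr (.inl ⟨l, t⟩) => exponent (k - l - t) t l 0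
  | .inr (.inr ⟨l, t⟩) => exponent 0 l t (k - l - t)

theorem standardExponentB_injective (n k : ℕ) : Function.Injective (standardExponentB n k) := by
  rintro (s | ⟨l, s⟩ | ⟨l, s⟩) (t | ⟨m, t⟩ | ⟨m, t⟩) h <;>
  · have hs := s.2
    have ht := t.2
    have h0 := DFunLike.congr_fun h 0
    have h1 := DFunLike.congr_fun h 1
    have h2 := DFunLike.congr_fun h 2
    have h3 := DFunLike.congr_fun h 3
    simp only [standardExponentB, exponent_zero, exponent_one, exponent_two, exponent_three]
      at h0 h1 h2 h3
    first
    | omega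
    | rw [Fin.ext h1]
    | obtain rfl := Fin.ext h2
      rw [Fin.ext h1]
    | obtain rfl := Fin.ext h1
      rw [Fin.ext h2]

/-- The three families are `z₁ = z₄ = 0`, `z₁` present and `z₄` present. The bound `t < k - l` makes
the exponent of `z₁`, respectively `z₄`, positive, which keeps the families disjoint. -/
theorem mem_range_standardExponentB_iff (n k : ℕ) (α : Fin 4 →₀ ℕ) :
    α ∈ Set.range (standardExponentB n k) ↔ α.degree = k ∧ ∀ ρ ∈ relExponentsB n, ¬ ρ ≤ α := by
  rw [forall_relExponentsB_not_le_iff, degree_fin_four]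
  constructor
  · rintro ⟨t | ⟨l, t⟩ | ⟨l, t⟩, rfl⟩ <;>
    · have ht := t.2
      simp only [standardExponentB, exponent_zero, exponent_one, exponent_two, exponent_three,
        true_or, or_true, and_true, true_and]
      omega
  · rintro ⟨hd, h1, h2, h3⟩
    by_cases h0 : α 0 = 0
    · by_cases h3 : α 3 = 0
      · exact ⟨.inl ⟨α 1, by omega⟩, exponent_ext h0.symm rfl (show k - α 1 = α 2 by omega) h3.symm⟩
      · exact ⟨.inr (.inr ⟨⟨α 1, by omega⟩, ⟨α 2, by simp only; omega⟩⟩),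
          exponent_ext h0.symm rfl rfl (show k - α 1 - α 2 = α 3 by omega)⟩
    · exact ⟨.inr (.inl ⟨⟨α 2, by omega⟩, ⟨α 1, by simp only; omega⟩⟩),
        exponent_ext (show k - α 2 - α 1 = α 0 by omega) rfl rfl (show 0 = α 3 by omega)⟩

theorem ceil_div_sub_bounds {a b r : ℕ} (ha : 0 < a) (hab : a < b)
    (hr : r = ⌈(b : ℚ) / ((b : ℚ) - (a : ℚ))⌉₊) :
    ∃ n, r = n + 1 ∧ n * (b - a) < b ∧ b ≤ (n + 1) * (b - a) := by
  have hd : (0 : ℚ) < (b : ℚ) - a := sub_pos.mpr (by exact_mod_cast hab)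
  have hb : (0 : ℚ) < b := by exact_mod_cast ha.trans hab
  have h1 : (b : ℚ) / ((b : ℚ) - a) ≤ r := hr ▸ Nat.le_ceil _
  have h2 : (r : ℚ) < (b : ℚ) / ((b : ℚ) - a) + 1 := hr ▸ Nat.ceil_lt_add_one (by positivity)
  have hr0 : r ≠ 0 := by
    rintro rfl
    have := div_pos hb hd
    simp only [Nat.cast_zero] at h1
    linarith
  obtain ⟨n, rfl⟩ := Nat.exists_eq_succ_of_ne_zero hr0
  refine ⟨n, rfl, ?_, ?_⟩
  · have : (n : ℚ) < (b : ℚ) / ((b : ℚ) - a) := by push_cast at h2; linarith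
    rw [lt_div_iff₀ hd, ← Nat.cast_sub hab.le] at this
    exact_mod_cast this
  · rw [div_le_iff₀ hd, ← Nat.cast_sub hab.le] at h1
    exact_mod_cast h1

end SymmetricFiberCone

theorem theorem3p5 {K : Type*} [Field K] (a b c : ℕ) (ha : 0 < a) (hab : a < b) (hbc : b < c) :
    (2 * a ≥ c →
      (∃ e : (MvPolynomial (Fin 4) K ⧸ relIdealA K) ≃ₐ[K] FiberCone (symmIdeal K a b c),
        ∀ i, e (Ideal.Quotient.mk _ (MvPolynomial.X i)) = symmClass K a b c i) ∧
      FiberCone.hilbertSeries (symmIdeal K a b c) =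
        (1 + 2 * PowerSeries.X) * ((1 - PowerSeries.X) ^ 2)⁻¹ ∧
      IsCohenMacaulayRing (FiberCone (symmIdeal K a b c))) ∧
    (∀ r : ℕ, r = ⌈(b : ℚ) / ((b : ℚ) - (a : ℚ))⌉₊ →
      (c : ℤ) > r * ((b : ℤ) - a) + a →
      (∃ e : (MvPolynomial (Fin 4) K ⧸ relIdealB K r) ≃ₐ[K] FiberCone (symmIdeal K a b c),
        ∀ i, e (Ideal.Quotient.mk _ (MvPolynomial.X i)) = symmClass K a b c i) ∧
      FiberCone.hilbertSeries (symmIdeal K a b c) =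
        (1 + 2 * ∑ i ∈ Finset.Icc 1 (r - 1), PowerSeries.X ^ i) *
          ((1 - PowerSeries.X) ^ 2)⁻¹ ∧
      IsCohenMacaulayRing (FiberCone (symmIdeal K a b c))) := by
  have hI := symmIdeal_eq_span_monomial K a b c
  constructor
  · intro hac
    have hR := exists_lt_of_mem_relExponentsA hab hac
    have hS : ∀ α, (∀ ρ ∈ relExponentsA, ¬ ρ ≤ α) → IsRigidExponent (symmExponent a b c) α :=
      fun α hα => isRigidExponent_of_add_le_one hab hbc hac
        ((forall_relExponentsA_not_le_iff α).mp hα)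
    obtain ⟨e, he⟩ := exists_algEquiv_symmClass relExponentsA hR hS _
      (relIdealA_eq_span_monomial K)
    refine ⟨⟨e, he⟩, ?_, isCohenMacaulayRing_of_equiv_relIdealA e.toRingEquiv⟩
    ext k
    -- The numerator `1 + 2t` is the case `n = 1` of the general one.
    have h := coeff_one_add_mul_inv_one_sub_X_sq 1 k
    rw [Finset.Icc_self, Finset.sum_singleton, pow_one] at h
    rw [h, FiberCone.hilbertSeries, PowerSeries.coeff_mk,
      FiberCone.finrank_component_eq_card hI relExponentsA hR hS k _
        (standardExponentA_injective k) (mem_range_standardExponentA_iff k)]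
    simp only [Fintype.card_sum, Fintype.card_fin, Finset.sum_range_one]
    congr 1
    omega
  · intro r hr hc
    obtain ⟨n, rfl, hn, hn'⟩ := ceil_div_sub_bounds ha hab hr
    have hc' : (n + 1) * (b - a) + a < c := by
      zify [hab.le]
      exact_mod_cast hc
    have hR := exists_lt_of_mem_relExponentsB hab hn' hc'
    -- The bound `a + b < c` needed here follows from `hn'` and `hc'`.
    have hS : ∀ α, (∀ ρ ∈ relExponentsB n, ¬ ρ ≤ α) → IsRigidExponent (symmExponent a b c) α :=
      fun α hα => isRigidExponent_of_forall_not_le hab (by omega) hn hα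
    obtain ⟨e, he⟩ := exists_algEquiv_symmClass (relExponentsB n) hR hS _
      (relIdealB_eq_span_monomial K n)
    refine ⟨⟨e, he⟩, ?_, isCohenMacaulayRing_of_equiv_relIdealB e.toRingEquiv⟩
    ext k
    rw [Nat.add_sub_cancel, coeff_one_add_mul_inv_one_sub_X_sq, FiberCone.hilbertSeries,
      PowerSeries.coeff_mk,
      FiberCone.finrank_component_eq_card hI (relExponentsB n) hR hS k _
        (standardExponentB_injective n k) (mem_range_standardExponentB_iff n k)]
    simp only [Fintype.card_sum, Fintype.card_sigma, Fintype.card_fin,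
      Fin.sum_univ_eq_sum_range (fun l => k - l) n]
    congr 1
    omega
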